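/- For a metric space $(M,\rho)$ with a distinguished point $o\in M$, let $\operatorname{Lip}_0(M)$ be the real normed space of all Lipschitz functions $f:M\to\mathbb{R}$ with $f(o)=0$, with pointwise operations and the norm $$\|f\|_{\operatorname{Lip}}=\sup_{x\neq y\in M}\frac{|f(x)-f(y)|}{\rho(x,y)}$$ (the supremum of the empty set being $0$). Let $d\in\mathbb{N}$ and $p,q\in[1,\infty]$. Equip $\mathbb{Z}^d$ with the metric $\rho(x,y)=\|x-y\|_p$ and $\mathbb{R}^d$ with the metric $\rho(x,y)=\|x-y\|_q$, where $\|\cdot\|_p$ and $\|\cdot\|_q$ are the $\ell_p$- and $\ell_q$-norms, and take the origin as distinguished point in both spaces. Then $\operatorname{Lip}_0(\mathbb{Z}^d)$ and $\operatorname{Lip}_0(\mathbb{R}^d)$ are linearly isomorphic as Banach spaces, that is, there is a linear bijection $T:\operatorname{Lip}_0(\mathbb{Z}^d)\to\operatorname{Lip}_0(\mathbb{R}^d)$ such that $T$ and $T^{-1}$ are bounded. In particular this holds when both $\mathbb{Z}^d$ and $\mathbb{R}^d$ carry the Euclidean metric ($p=q=2$). -/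

import Mathlib

open scoped NNReal ENNReal

noncomputable section

/-- The real vector space of the Lipschitz functions `M → ℝ` that vanish at the
distinguished point `o`. -/
def lipZeroSubmodule (M : Type*) [MetricSpace M] (o : M) : Submodule ℝ (M → ℝ) where
  carrier := {f | (∃ K : ℝ≥0, LipschitzWith K f) ∧ f o = 0}
  add_mem' := by
    rintro f g ⟨⟨K, hf⟩, hf0⟩ ⟨⟨L, hg⟩, hg0⟩
    exact ⟨⟨K + L, hf.add hg⟩, by simp [hf0, hg0]⟩
  zero_mem' := ⟨⟨0, LipschitzWith.const 0⟩, rfl⟩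
  smul_mem' := by
    rintro c f ⟨⟨K, hf⟩, hf0⟩
    refine ⟨⟨‖c‖₊ * K, ?_⟩, by simp [hf0]⟩
    refine LipschitzWith.of_dist_le_mul fun x y => ?_
    have h := hf.dist_le_mul x y
    simp only [Pi.smul_apply, dist_smul₀, NNReal.coe_mul, coe_nnnorm, mul_assoc]
    exact mul_le_mul_of_nonneg_left h (norm_nonneg c)

/-- The space `Lip₀(M)` of a pointed metric space `(M, o)`. It is a type of its own, so that it
carries the Lipschitz norm defined below and not the topology of pointwise convergence. -/
def LipZero (M : Type*) [MetricSpace M] (o : M) : Type _ := ↥(lipZeroSubmodule M o)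

namespace LipZero

variable {M : Type*} [MetricSpace M] {o : M}

instance : AddCommGroup (LipZero M o) := inferInstanceAs (AddCommGroup ↥(lipZeroSubmodule M o))

instance : Module ℝ (LipZero M o) := inferInstanceAs (Module ℝ ↥(lipZeroSubmodule M o))

instance : CoeFun (LipZero M o) (fun _ => M → ℝ) := ⟨fun f => f.1⟩

/-- The Lipschitz norm, the supremum of `|f x - f y| / d(x, y)`. The pairs with `x = y`
contribute the value `0 / 0 = 0` and do not affect it. -/
instance : Norm (LipZero M o) := ⟨fun f => ⨆ p : M × M, |f p.1 - f p.2| / dist p.1 p.2⟩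

theorem norm_def (f : LipZero M o) :
    ‖f‖ = ⨆ p : M × M, |f p.1 - f p.2| / dist p.1 p.2 := rfl

theorem bddAbove (f : LipZero M o) :
    BddAbove (Set.range fun p : M × M => |f p.1 - f p.2| / dist p.1 p.2) := by
  obtain ⟨K, hK⟩ := f.2.1
  refine ⟨K, ?_⟩
  rintro _ ⟨⟨x, y⟩, rfl⟩
  exact div_le_of_le_mul₀ dist_nonneg K.2 (hK.dist_le_mul x y)

theorem norm_nonneg' (f : LipZero M o) : 0 ≤ ‖f‖ :=
  Real.iSup_nonneg fun _ => div_nonneg (abs_nonneg _) dist_nonneg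

theorem abs_sub_le (f : LipZero M o) (x y : M) : |f x - f y| ≤ ‖f‖ * dist x y := by
  rcases eq_or_ne x y with rfl | h
  · simp
  · exact (div_le_iff₀ (dist_pos.2 h)).1 (le_ciSup (bddAbove f) (x, y))

theorem norm_le {f : LipZero M o} {C : ℝ} (hC : 0 ≤ C)
    (h : ∀ x y, |f x - f y| ≤ C * dist x y) : ‖f‖ ≤ C :=
  Real.iSup_le (fun p => div_le_of_le_mul₀ dist_nonneg hC (h p.1 p.2)) hC

theorem norm_smul_le' (c : ℝ) (f : LipZero M o) : ‖c • f‖ ≤ |c| * ‖f‖ := by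
  refine norm_le (mul_nonneg (abs_nonneg c) (norm_nonneg' f)) fun x y => ?_
  change |c * f x - c * f y| ≤ _
  rw [← mul_sub, abs_mul, mul_assoc]
  exact mul_le_mul_of_nonneg_left (abs_sub_le f x y) (abs_nonneg c)

theorem core : NormedSpace.Core ℝ (LipZero M o) where
  norm_nonneg := norm_nonneg'
  norm_smul c f := by
    refine le_antisymm (norm_smul_le' c f) ?_
    rcases eq_or_ne c 0 with rfl | hc
    · simpa using norm_nonneg' ((0 : ℝ) • f)
    · have h := norm_smul_le' c⁻¹ (c • f)
      rw [smul_smul, inv_mul_cancel₀ hc, one_smul, abs_inv] at h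
      rw [Real.norm_eq_abs]
      exact (le_inv_mul_iff₀ (abs_pos.2 hc)).1 h
  norm_triangle f g := by
    refine norm_le (add_nonneg (norm_nonneg' f) (norm_nonneg' g)) fun x y => ?_
    change |(f x + g x) - (f y + g y)| ≤ _
    rw [add_sub_add_comm, add_mul]
    exact (abs_add_le _ _).trans (add_le_add (abs_sub_le f x y) (abs_sub_le g x y))
  norm_eq_zero_iff f := by
    constructor
    · intro h
      refine Subtype.ext (funext fun x => ?_)
      have hx := abs_sub_le f x o
      rw [h, zero_mul] at hx
      have h2 : f x - f o = 0 := abs_nonpos_iff.1 hx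
      rw [show f o = 0 from f.2.2, sub_zero] at h2
      exact h2
    · rintro rfl
      refine le_antisymm (norm_le le_rfl fun x y => ?_) (norm_nonneg' _)
      change |(0 : ℝ) - 0| ≤ _
      simp

instance : NormedAddCommGroup (LipZero M o) := NormedAddCommGroup.ofCore core

instance : NormedSpace ℝ (LipZero M o) := NormedSpace.ofCore core

end LipZero

end

open Filter Topology MeasureTheory
open scoped BoundedContinuousFunction

/-! All `ℓ_p`-metrics on a finite power are bi-Lipschitz equivalent to the supremum metric, so only
that metric matters. Write `A` for the space over the lattice, `B` for the space over `ℝ ^ ι`, and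
`ℓ_∞(B)` for bounded sequences in `B`. Pełczyński's method (`nonempty_equiv_of_complemented`) gives
`A ≅ ℓ_∞(B) ≅ B` from two facts.

`A` is complemented in `B`: multilinear interpolation is a bounded right inverse of restriction to
the lattice (`restriction_extension`).

`ℓ_∞(B)` is complemented in `A` (`zoomLimitL_fillBlocksL`): the lattice contains disjoint balls of
growing radii, and Lipschitz functions supported in them can be glued at the cost of a factor 2.
Each `F m` is placed in infinitely many balls, cut off and magnified by `2 ^ n`. Seen at scale `2 ^
n` the lattice becomes dense and the ball exhausts `ℝ ^ ι`, so rescaling recovers `F m` as `n → ∞`.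
An ultrafilter limit extends this recovery to a bounded linear operator on all of `A`. -/

/-- A complemented subspace, presented by an embedding and a projection, splits off as a factor. -/
theorem exists_equiv_prod_of_leftInverse {A B : Type*} [NormedAddCommGroup A] [NormedSpace ℝ A]
    [NormedAddCommGroup B] [NormedSpace ℝ B] (J : A →L[ℝ] B) (P : B →L[ℝ] A)
    (h : Function.LeftInverse P J) :
    ∃ W : Submodule ℝ B, Nonempty (B ≃L[ℝ] A × W) :=
  ⟨_, ⟨ContinuousLinearEquiv.equivOfRightInverse P J h⟩⟩

/-! ### Bounded sequences and Pełczyński's decomposition method. -/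

section BoundedSeq

variable {A B : Type*} [NormedAddCommGroup A] [NormedSpace ℝ A]
  [NormedAddCommGroup B] [NormedSpace ℝ B]

/-- Isomorphic spaces have isomorphic spaces of bounded sequences. -/
noncomputable def boundedSeqCongr (e : A ≃L[ℝ] B) : (ℕ →ᵇ A) ≃L[ℝ] (ℕ →ᵇ B) :=
  ContinuousLinearEquiv.equivOfInverse
    ((e : A →L[ℝ] B).compLeftContinuousBounded ℕ)
    ((e.symm : B →L[ℝ] A).compLeftContinuousBounded ℕ)
    (fun f => by ext n; simp) (fun f => by ext n; simp)

/-- Bounded sequences in `A × B` absorb a factor `A`, by a shift of the first coordinate. -/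
theorem nonempty_prod_boundedSeq_equiv :
    Nonempty ((A × (ℕ →ᵇ A × B)) ≃L[ℝ] (ℕ →ᵇ A × B)) := by
  have hto : ∀ (x : A × (ℕ →ᵇ A × B)) (n : ℕ),
      ‖((Nat.casesOn n x.1 fun k => (x.2 k).1 : A), (x.2 n).2)‖ ≤ ‖x‖ := by
    intro x n
    have h2 : ∀ n, ‖x.2 n‖ ≤ ‖x‖ := fun n => (x.2.norm_coe_le_norm n).trans (norm_snd_le x)
    refine max_le ?_ ((norm_snd_le (x.2 n)).trans (h2 n))
    cases n with
    | zero => exact norm_fst_le x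
    | succ k => exact (norm_fst_le (x.2 k)).trans (h2 k)
  have hinv : ∀ (f : ℕ →ᵇ A × B) (n : ℕ), ‖((f (n + 1)).1, (f n).2)‖ ≤ ‖f‖ := fun f n =>
    max_le ((norm_fst_le (f (n + 1))).trans (f.norm_coe_le_norm _))
      ((norm_snd_le (f n)).trans (f.norm_coe_le_norm _))
  let e : (A × (ℕ →ᵇ A × B)) ≃ₗ[ℝ] (ℕ →ᵇ A × B) :=
    { toFun := fun x => BoundedContinuousFunction.ofNormedAddCommGroupDiscrete _ ‖x‖ (hto x)
      invFun := fun f => ((f 0).1,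
        BoundedContinuousFunction.ofNormedAddCommGroupDiscrete _ ‖f‖ (hinv f))
      map_add' := fun x y => by
        ext n
        · cases n <;> rfl
        · rfl
      map_smul' := fun c x => by
        ext n
        · cases n <;> rfl
        · rfl
      left_inv := fun x => rfl
      right_inv := fun f => by
        ext n
        · cases n <;> rfl
        · rfl }
  refine ⟨e.toContinuousLinearEquivOfBounds 1 1 (fun x => ?_) (fun f => ?_)⟩
  · rw [one_mul]
    exact BoundedContinuousFunction.norm_ofNormedAddCommGroup_le _ (norm_nonneg x) (hto x)
  · rw [one_mul]
    exact max_le ((norm_fst_le (f 0)).trans (f.norm_coe_le_norm _))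
      (BoundedContinuousFunction.norm_ofNormedAddCommGroup_le _ (norm_nonneg f) (hinv f))

/-- Two bounded sequences are interleaved into one. -/
theorem nonempty_boundedSeq_prod_self_equiv :
    Nonempty (((ℕ →ᵇ A) × (ℕ →ᵇ A)) ≃L[ℝ] (ℕ →ᵇ A)) := by
  let s : ℕ ⊕ ℕ ≃ ℕ := Equiv.natSumNatEquivNat
  have hbound : ∀ (x : (ℕ →ᵇ A) × (ℕ →ᵇ A)) (n : ℕ), ‖Sum.elim x.1 x.2 (s.symm n)‖ ≤ ‖x‖ := by
    intro x n
    rcases s.symm n with k | k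
    · exact (x.1.norm_coe_le_norm k).trans (norm_fst_le x)
    · exact (x.2.norm_coe_le_norm k).trans (norm_snd_le x)
  let e : ((ℕ →ᵇ A) × (ℕ →ᵇ A)) ≃ₗ[ℝ] (ℕ →ᵇ A) :=
    { toFun := fun x => BoundedContinuousFunction.ofNormedAddCommGroupDiscrete
        (fun n => Sum.elim x.1 x.2 (s.symm n)) ‖x‖ (hbound x)
      invFun := fun f =>
        (BoundedContinuousFunction.ofNormedAddCommGroupDiscrete (fun n => f (s (.inl n))) ‖f‖
            fun n => f.norm_coe_le_norm _,
          BoundedContinuousFunction.ofNormedAddCommGroupDiscrete (fun n => f (s (.inr n))) ‖f‖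
            fun n => f.norm_coe_le_norm _)
      map_add' := fun x y => by
        ext n
        change Sum.elim (x + y).1 (x + y).2 (s.symm n) =
          Sum.elim x.1 x.2 (s.symm n) + Sum.elim y.1 y.2 (s.symm n)
        rcases s.symm n with k | k <;> rfl
      map_smul' := fun c x => by
        ext n
        change Sum.elim (c • x).1 (c • x).2 (s.symm n) = c • Sum.elim x.1 x.2 (s.symm n)
        rcases s.symm n with k | k <;> rfl
      left_inv := fun x => by
        refine Prod.ext ?_ ?_
        · ext n
          change Sum.elim x.1 x.2 (s.symm (s (.inl n))) = x.1 n
          rw [s.symm_apply_apply]; rfl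
        · ext n
          change Sum.elim x.1 x.2 (s.symm (s (.inr n))) = x.2 n
          rw [s.symm_apply_apply]; rfl
      right_inv := fun f => by
        ext n
        change Sum.elim (fun k => f (s (.inl k))) (fun k => f (s (.inr k))) (s.symm n) = f n
        conv_rhs => rw [← s.apply_symm_apply n]
        rcases s.symm n with k | k <;> rfl }
  refine ⟨e.toContinuousLinearEquivOfBounds 1 1 (fun x => ?_) (fun f => ?_)⟩
  · rw [one_mul]
    exact BoundedContinuousFunction.norm_ofNormedAddCommGroup_le _ (norm_nonneg x) (hbound x)
  · rw [one_mul]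
    exact max_le (BoundedContinuousFunction.norm_ofNormedAddCommGroup_le _ (norm_nonneg f)
      fun _ => f.norm_coe_le_norm _)
      (BoundedContinuousFunction.norm_ofNormedAddCommGroup_le _ (norm_nonneg f)
      fun _ => f.norm_coe_le_norm _)

/-- Pełczyński's decomposition method: if `A` is complemented in `B` and the space of bounded
sequences in `B` is complemented in `A`, then `A` is isomorphic to this space of sequences. -/
theorem nonempty_equiv_boundedSeq (J : A →L[ℝ] B) (P : B →L[ℝ] A) (h : Function.LeftInverse P J)
    (J' : (ℕ →ᵇ B) →L[ℝ] A) (P' : A →L[ℝ] (ℕ →ᵇ B)) (h' : Function.LeftInverse P' J') :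
    Nonempty (A ≃L[ℝ] (ℕ →ᵇ B)) := by
  obtain ⟨V, ⟨eV⟩⟩ := exists_equiv_prod_of_leftInverse J P h
  obtain ⟨W, ⟨eW⟩⟩ := exists_equiv_prod_of_leftInverse J' P' h'
  obtain ⟨shift⟩ := nonempty_prod_boundedSeq_equiv (A := A) (B := V)
  obtain ⟨double⟩ := nonempty_boundedSeq_prod_self_equiv (A := B)
  let absorb : (A × (ℕ →ᵇ B)) ≃L[ℝ] (ℕ →ᵇ B) :=
    (((ContinuousLinearEquiv.refl ℝ A).prodCongr (boundedSeqCongr eV)).trans shift).trans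
      (boundedSeqCongr eV).symm
  -- `A ≅ ℓ_∞(B) × W ≅ ℓ_∞(B) × ℓ_∞(B) × W ≅ ℓ_∞(B) × A`, and the last product is absorbed because
  -- `B ≅ A × V`.
  exact ⟨((((eW.trans (double.symm.prodCongr (ContinuousLinearEquiv.refl ℝ W))).trans
    (ContinuousLinearEquiv.prodAssoc ℝ _ _ _)).trans
    ((ContinuousLinearEquiv.refl ℝ _).prodCongr eW.symm)).trans
    (ContinuousLinearEquiv.prodComm ℝ _ _)).trans absorb⟩

/-- If `A` is complemented in `B` and the space of bounded sequences in `B` is complemented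
in `A`, then `A` and `B` are isomorphic. -/
theorem nonempty_equiv_of_complemented (J : A →L[ℝ] B) (P : B →L[ℝ] A)
    (h : Function.LeftInverse P J)
    (J' : (ℕ →ᵇ B) →L[ℝ] A) (P' : A →L[ℝ] (ℕ →ᵇ B)) (h' : Function.LeftInverse P' J') :
    Nonempty (A ≃L[ℝ] B) := by
  obtain ⟨e⟩ := nonempty_equiv_boundedSeq J P h J' P' h'
  -- The same with `B` in place of `A`: `ℓ_∞(B)` is complemented in `B` through `A`.
  obtain ⟨e'⟩ := nonempty_equiv_boundedSeq (ContinuousLinearMap.id ℝ B)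
    (ContinuousLinearMap.id ℝ B) (fun _ => rfl) (J.comp J') (P'.comp P) (fun x => by
      simp only [ContinuousLinearMap.comp_apply, h _, h' _])
  exact ⟨e.trans e'.symm⟩

end BoundedSeq

/-! ### Functoriality and change of metric. -/

namespace LipZero

theorem apply_base {M : Type*} [MetricSpace M] {o : M} (f : LipZero M o) : f o = 0 := f.2.2

/-- A function with a Lipschitz estimate and the value `0` at the distinguished point. -/
def mk' {M : Type*} [MetricSpace M] {o : M} (f : M → ℝ) (K : ℝ)
    (h : ∀ x y, |f x - f y| ≤ K * dist x y) (h0 : f o = 0) : LipZero M o :=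
  ⟨f, ⟨K.toNNReal, LipschitzWith.of_dist_le_mul fun x y =>
    (h x y).trans (mul_le_mul_of_nonneg_right (Real.le_coe_toNNReal K) dist_nonneg)⟩, h0⟩

theorem ext {M : Type*} [MetricSpace M] {o : M} {f g : LipZero M o} (h : ∀ x, f x = g x) :
    f = g := Subtype.ext (funext h)

/-- Composition with a Lipschitz map that preserves the distinguished point. -/
noncomputable def comp {M N : Type*} [MetricSpace M] [MetricSpace N] {o : M} {o' : N}
    (φ : M → N) {K : ℝ≥0} (hφ : LipschitzWith K φ) (h0 : φ o = o') :
    LipZero N o' →L[ℝ] LipZero M o :=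
  LinearMap.mkContinuous
    { toFun := fun f => mk' (fun x => f (φ x)) (‖f‖ * K) (fun x y => by
        rw [mul_assoc]
        exact (f.abs_sub_le _ _).trans (mul_le_mul_of_nonneg_left (hφ.dist_le_mul x y)
          (norm_nonneg f))) (by rw [h0]; exact f.apply_base)
      map_add' := fun f g => rfl
      map_smul' := fun c f => rfl } K fun f =>
    norm_le (mul_nonneg K.2 (norm_nonneg f)) fun x y => by
      rw [mul_comm (K : ℝ), mul_assoc]
      exact (f.abs_sub_le _ _).trans (mul_le_mul_of_nonneg_left (hφ.dist_le_mul x y)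
        (norm_nonneg f))

theorem comp_apply {M N : Type*} [MetricSpace M] [MetricSpace N] {o : M} {o' : N}
    (φ : M → N) {K : ℝ≥0} (hφ : LipschitzWith K φ) (h0 : φ o = o') (f : LipZero N o') (x : M) :
    comp φ hφ h0 f x = f (φ x) := rfl

/-- A bi-Lipschitz bijection of pointed metric spaces induces an isomorphism. -/
noncomputable def congr {M N : Type*} [MetricSpace M] [MetricSpace N] {o : M} {o' : N}
    (φ : M ≃ N) {K L : ℝ≥0} (hφ : LipschitzWith K φ) (hψ : LipschitzWith L φ.symm)
    (h0 : φ o = o') : LipZero N o' ≃L[ℝ] LipZero M o :=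
  ContinuousLinearEquiv.equivOfInverse (comp φ hφ h0)
    (comp φ.symm hψ (φ.symm_apply_eq.2 h0.symm))
    (fun f => ext fun x => by rw [comp_apply, comp_apply, φ.apply_symm_apply])
    (fun f => ext fun x => by rw [comp_apply, comp_apply, φ.symm_apply_apply])

/-- The `ℓ_p`-metric and the supremum metric yield isomorphic spaces. -/
noncomputable def piLpEquiv (p : ℝ≥0∞) [Fact (1 ≤ p)] (ι : Type*) [Fintype ι] (G : Type*)
    [MetricSpace G] [Zero G] :
    LipZero (ι → G) 0 ≃L[ℝ] LipZero (PiLp p fun _ : ι => G) (WithLp.toLp p 0) :=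
  congr (WithLp.equiv p (ι → G)) (PiLp.lipschitzWith_ofLp p fun _ : ι => G)
    ((PiLp.antilipschitzWith_ofLp p fun _ : ι => G).to_rightInverse
      (WithLp.equiv p (ι → G)).right_inv) rfl

end LipZero

/-! ### Averages of integer parts. -/

/-- The average of `⌊x + t⌋` over a period is `x`. -/
theorem integral_floor_add (x : ℝ) : ∫ t in Set.Ico (0 : ℝ) 1, ((⌊x + t⌋ : ℤ) : ℝ) = x := by
  -- `Int.fract` has mean `1 / 2` over every period; this cancels the mean of `t` in `x + t -
  -- Int.fract (x + t)`.
  have hper : ∫ t in (0 : ℝ)..1, Int.fract (x + t) = 1 / 2 := by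
    rw [intervalIntegral.integral_comp_add_left (fun t => Int.fract t) x, add_zero,
      (Int.fract_periodic ℝ).intervalIntegral_add_eq x 0, zero_add]
    rw [intervalIntegral.integral_of_le zero_le_one, ← integral_Ico_eq_integral_Ioc,
      setIntegral_congr_fun measurableSet_Ico (g := fun t => t)
        (fun t ht => Int.fract_eq_self.2 ⟨ht.1, ht.2⟩), integral_Ico_eq_integral_Ioc,
      ← intervalIntegral.integral_of_le zero_le_one, integral_id]
    norm_num
  have hfl : ∀ t : ℝ, ((⌊x + t⌋ : ℤ) : ℝ) = (x + t) - Int.fract (x + t) := fun t =>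
    (Int.self_sub_fract _).symm
  have hint : IntervalIntegrable (fun t => Int.fract (x + t)) volume 0 1 := by
    rw [intervalIntegrable_iff_integrableOn_Ioc_of_le zero_le_one]
    refine Measure.integrableOn_of_bounded (M := 1) (by simp)
      (by fun_prop : Measurable fun t : ℝ => Int.fract (x + t)).aestronglyMeasurable ?_
    exact ae_of_all _ fun t => by
      rw [Real.norm_eq_abs, abs_of_nonneg (Int.fract_nonneg _)]
      exact (Int.fract_lt_one _).le
  simp_rw [hfl]
  rw [integral_Ico_eq_integral_Ioc, ← intervalIntegral.integral_of_le zero_le_one,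
    intervalIntegral.integral_sub ?_ hint, hper,
    intervalIntegral.integral_add (by simp) (by simp)]
  · simp
  · exact (by fun_prop : Continuous fun t : ℝ => x + t).intervalIntegrable _ _

theorem integrableOn_floor_add (x : ℝ) :
    IntegrableOn (fun t => ((⌊x + t⌋ : ℤ) : ℝ)) (Set.Ico (0 : ℝ) 1) := by
  refine Measure.integrableOn_of_bounded (M := |x| + 2) (by simp)
    (by fun_prop : Measurable fun t : ℝ => ((⌊x + t⌋ : ℤ) : ℝ)).aestronglyMeasurable ?_
  filter_upwards [ae_restrict_mem measurableSet_Ico] with t ht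
  have h1 := Int.floor_le (x + t)
  have h2 := Int.lt_floor_add_one (x + t)
  rw [Real.norm_eq_abs, abs_le]
  have := abs_le.1 (le_refl |x|)
  constructor <;> linarith [ht.1, ht.2]

/-- By monotonicity of the floor the difference has the same sign for all `t`, so the absolute value
leaves the integral. -/
theorem integral_abs_floor_add_sub (x y : ℝ) :
    ∫ t in Set.Ico (0 : ℝ) 1, |((⌊x + t⌋ : ℤ) : ℝ) - ((⌊y + t⌋ : ℤ) : ℝ)| = |x - y| := by
  wlog h : y ≤ x generalizing x y
  · rw [abs_sub_comm x y, ← this y x (le_of_not_ge h)]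
    simp_rw [abs_sub_comm]
  have hm : ∀ t : ℝ, 0 ≤ ((⌊x + t⌋ : ℤ) : ℝ) - ((⌊y + t⌋ : ℤ) : ℝ) := fun t =>
    sub_nonneg.2 (Int.cast_le.2 (Int.floor_le_floor (by linarith)))
  simp_rw [abs_of_nonneg (hm _)]
  rw [integral_sub (integrableOn_floor_add x) (integrableOn_floor_add y), integral_floor_add,
    integral_floor_add, abs_of_nonneg (sub_nonneg.2 h)]

/-! ### Multilinear interpolation from the lattice. -/

section Cube

variable {ι : Type*}

/-- The coordinatewise integer part. -/
noncomputable def floorVec (x : ι → ℝ) : ι → ℤ := fun i => ⌊x i⌋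

theorem measurable_floorVec : Measurable (floorVec : (ι → ℝ) → ι → ℤ) :=
  measurable_pi_lambda _ fun i => Int.measurable_floor.comp (measurable_pi_apply i)

variable [Fintype ι]

/-- Lebesgue measure on the half-open unit cube. -/
noncomputable def cubeMeasure (ι : Type*) [Fintype ι] : Measure (ι → ℝ) :=
  volume.restrict (Set.univ.pi fun _ => Set.Ico (0 : ℝ) 1)

theorem cubeMeasure_eq_pi :
    cubeMeasure ι = Measure.pi fun _ : ι => (volume : Measure ℝ).restrict (Set.Ico (0 : ℝ) 1) :=
  Measure.restrict_pi_pi _ _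

instance : IsProbabilityMeasure ((volume : Measure ℝ).restrict (Set.Ico (0 : ℝ) 1)) :=
  ⟨by simp⟩

instance : IsProbabilityMeasure (cubeMeasure ι) := by
  rw [cubeMeasure_eq_pi]; infer_instance

theorem ae_cubeMeasure : ∀ᵐ t ∂cubeMeasure ι, ∀ i, t i ∈ Set.Ico (0 : ℝ) 1 := by
  filter_upwards [ae_restrict_mem (MeasurableSet.univ_pi fun _ => measurableSet_Ico)] with t ht i
  exact ht i (Set.mem_univ i)

theorem measurePreserving_eval_cubeMeasure (i : ι) : MeasurePreserving (Function.eval i)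
    (cubeMeasure ι) ((volume : Measure ℝ).restrict (Set.Ico (0 : ℝ) 1)) := by
  rw [cubeMeasure_eq_pi]
  exact measurePreserving_eval _ i

theorem dist_floorVec_le (x y : ι → ℝ) : dist (floorVec x) (floorVec y) ≤ dist x y + 1 := by
  refine (dist_pi_le_iff (by positivity)).2 fun i => ?_
  have h := abs_le.1 ((Real.dist_eq _ _).symm.trans_le (dist_le_pi_dist x y i))
  rw [floorVec, floorVec, Int.dist_eq, abs_le]
  have h1 := Int.floor_le (x i)
  have h2 := Int.lt_floor_add_one (x i)
  have h3 := Int.floor_le (y i)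
  have h4 := Int.lt_floor_add_one (y i)
  constructor <;> linarith [h.1, h.2]

/-- Passing to the `ℓ_1`-sum lets the average be computed coordinate by coordinate. -/
theorem dist_le_sum_dist (x y : ι → ℤ) : dist x y ≤ ∑ i, |(x i : ℝ) - y i| := by
  refine (dist_pi_le_iff (Finset.sum_nonneg fun i _ => abs_nonneg _)).2 fun i => ?_
  rw [Int.dist_eq]
  exact Finset.single_le_sum (f := fun i => |(x i : ℝ) - y i|) (fun i _ => abs_nonneg _)
    (Finset.mem_univ i)

theorem integrable_abs_floor_sub (x y : ι → ℝ) (i : ι) : Integrable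
    (fun t : ι → ℝ => |((⌊x i + t i⌋ : ℤ) : ℝ) - ((⌊y i + t i⌋ : ℤ) : ℝ)|) (cubeMeasure ι) :=
  (measurePreserving_eval_cubeMeasure i).integrable_comp_of_integrable
    (g := fun t : ℝ => |((⌊x i + t⌋ : ℤ) : ℝ) - ((⌊y i + t⌋ : ℤ) : ℝ)|)
    ((integrableOn_floor_add (x i)).sub (integrableOn_floor_add (y i))).abs

theorem integral_abs_floor_sub (x y : ι → ℝ) (i : ι) :
    ∫ t, |((⌊x i + t i⌋ : ℤ) : ℝ) - ((⌊y i + t i⌋ : ℤ) : ℝ)| ∂cubeMeasure ι = |x i - y i| := by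
  rw [← integral_abs_floor_add_sub (x i) (y i), ← (measurePreserving_eval_cubeMeasure i).map_eq,
    integral_map (measurable_pi_apply i).aemeasurable
      (Measurable.aestronglyMeasurable (by fun_prop))]

namespace LipZero

theorem measurable_comp_floorVec (g : (ι → ℤ) → ℝ) (x : ι → ℝ) :
    Measurable fun t => g (floorVec (x + t)) :=
  (measurable_of_countable g).comp (measurable_floorVec.comp (measurable_const_add x))

theorem abs_sub_floorVec_le (g : LipZero (ι → ℤ) 0) (x y t : ι → ℝ) :
    |g (floorVec (x + t)) - g (floorVec (y + t))| ≤
      ‖g‖ * ∑ i, |((⌊x i + t i⌋ : ℤ) : ℝ) - ((⌊y i + t i⌋ : ℤ) : ℝ)| :=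
  (g.abs_sub_le _ _).trans (mul_le_mul_of_nonneg_left (dist_le_sum_dist _ _) (norm_nonneg g))

theorem integrable_comp_floorVec (g : LipZero (ι → ℤ) 0) (x : ι → ℝ) :
    Integrable (fun t => g (floorVec (x + t))) (cubeMeasure ι) := by
  refine Integrable.of_bound (measurable_comp_floorVec g x).aestronglyMeasurable
    (‖g‖ * (dist x 0 + 2)) ?_
  filter_upwards [ae_cubeMeasure (ι := ι)] with t ht
  have h1 := g.abs_sub_le (floorVec (x + t)) 0
  rw [g.apply_base, sub_zero] at h1
  refine h1.trans (mul_le_mul_of_nonneg_left ?_ (norm_nonneg g))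
  -- The base point is written as `floorVec t`, so that the bound compares `x + t` with `t`.
  have h2 : floorVec t = 0 := funext fun i => Int.floor_eq_zero_iff.2 (ht i)
  rw [← h2]
  refine (dist_floorVec_le _ _).trans ?_
  have h3 : dist (x + t) t = dist x 0 := by
    rw [dist_eq_norm, dist_eq_norm, add_sub_cancel_right, sub_zero]
  linarith

/-- The average of `g` over the integer parts of `x + t`, with `t` in the unit cube. This is the
multilinear interpolation of `g`. -/
noncomputable def average (g : (ι → ℤ) → ℝ) (x : ι → ℝ) : ℝ :=
  ∫ t, g (floorVec (x + t)) ∂cubeMeasure ι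

/-- At a lattice point the integer part of `z + t` is `z` for every `t` in the half-open cube. -/
theorem average_intCast (g : (ι → ℤ) → ℝ) (z : ι → ℤ) :
    average g (fun i => (z i : ℝ)) = g z := by
  have h : (fun t => g (floorVec ((fun i => (z i : ℝ)) + t))) =ᵐ[cubeMeasure ι] fun _ => g z := by
    filter_upwards [ae_cubeMeasure (ι := ι)] with t ht
    congr 1
    funext i
    rw [floorVec, Pi.add_apply, Int.floor_intCast_add, Int.floor_eq_zero_iff.2 (ht i), add_zero]
  rw [average, integral_congr_ae h]
  simp

/-- For a single `t` the integer parts may jump by `1` however close `x` and `y` are; only the mean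
of the jump in coordinate `i` equals `|x i - y i|`. The sum over coordinates gives the factor
`Fintype.card ι`. -/
theorem abs_average_sub_le (g : LipZero (ι → ℤ) 0) (x y : ι → ℝ) :
    |average g x - average g y| ≤ Fintype.card ι * ‖g‖ * dist x y := by
  rw [average, average, ← integral_sub (g.integrable_comp_floorVec x)
    (g.integrable_comp_floorVec y)]
  refine (abs_integral_le_integral_abs).trans ?_
  refine (integral_mono ((g.integrable_comp_floorVec x).sub (g.integrable_comp_floorVec y)).abs
    ((integrable_finsetSum _ fun i _ => integrable_abs_floor_sub x y i).const_mul ‖g‖)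
    (g.abs_sub_floorVec_le x y)).trans ?_
  rw [integral_const_mul, integral_finsetSum _ fun i _ => integrable_abs_floor_sub x y i]
  simp_rw [integral_abs_floor_sub]
  have h : ∑ i, |x i - y i| ≤ ∑ _i : ι, dist x y :=
    Finset.sum_le_sum fun i _ => (Real.dist_eq _ _).symm.trans_le (dist_le_pi_dist x y i)
  rw [Finset.sum_const, Finset.card_univ, nsmul_eq_mul] at h
  calc ‖g‖ * ∑ i, |x i - y i| ≤ ‖g‖ * (Fintype.card ι * dist x y) :=
        mul_le_mul_of_nonneg_left h (norm_nonneg g)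
    _ = _ := by ring

/-- Multilinear interpolation as a bounded operator. -/
noncomputable def extension (ι : Type*) [Fintype ι] :
    LipZero (ι → ℤ) 0 →L[ℝ] LipZero (ι → ℝ) 0 :=
  LinearMap.mkContinuous
    { toFun := fun g => mk' (average g) _ (abs_average_sub_le g) (by
        have h := average_intCast g 0
        rw [g.apply_base] at h
        rw [← h]
        congr 1
        funext i
        simp)
      map_add' := fun f g => ext fun x =>
        integral_add (f.integrable_comp_floorVec x) (g.integrable_comp_floorVec x)
      map_smul' := fun c g => ext fun x => integral_const_mul c _ }
    (Fintype.card ι) fun g => norm_le (by positivity) (abs_average_sub_le g)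

theorem isometry_intCast_pi :
    Isometry fun (z : ι → ℤ) (i : ι) => (z i : ℝ) :=
  Isometry.piMap (fun _ => ((↑) : ℤ → ℝ)) fun _ =>
    Isometry.of_dist_eq fun _ _ => Int.dist_cast_real _ _

/-- Restriction to the integer lattice. -/
noncomputable def restriction (ι : Type*) [Fintype ι] :
    LipZero (ι → ℝ) 0 →L[ℝ] LipZero (ι → ℤ) 0 :=
  comp (fun (z : ι → ℤ) (i : ι) => (z i : ℝ)) isometry_intCast_pi.lipschitz
    (funext fun _ => Int.cast_zero)

theorem restriction_extension :
    Function.LeftInverse (restriction ι) (extension ι) := fun g =>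
  ext fun z => average_intCast g z

end LipZero

end Cube

/-! ### Limits along an ultrafilter. -/

section Ultralimit

/-- The limit of a real sequence along a fixed nonprincipal ultrafilter. -/
noncomputable def ultralimit (u : ℕ → ℝ) : ℝ := limUnder (hyperfilter ℕ : Filter ℕ) u

/-- Compactness of `[-C, C]` makes the ultrafilter converge; without convergence `limUnder` is only
a default value. -/
theorem tendsto_ultralimit {u : ℕ → ℝ} {C : ℝ} (h : ∀ n, |u n| ≤ C) :
    Tendsto u (hyperfilter ℕ : Filter ℕ) (𝓝 (ultralimit u)) := by
  have hK : IsCompact (Set.Icc (-C) C) := isCompact_Icc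
  obtain ⟨a, -, ha⟩ := hK.ultrafilter_le_nhds ((hyperfilter ℕ).map u)
    (le_principal_iff.2 (Filter.mem_map.2 (Filter.univ_mem' fun n => abs_le.1 (h n))))
  exact tendsto_nhds_limUnder ⟨a, ha⟩

theorem ultralimit_eq_of_tendsto {u : ℕ → ℝ} {a : ℝ} (h : Tendsto u atTop (𝓝 a)) :
    ultralimit u = a :=
  (h.mono_left Nat.hyperfilter_le_atTop).limUnder_eq

end Ultralimit

/-! ### Cutoffs and glueing. -/

section Bump

variable {E : Type*} [NormedAddCommGroup E]

/-- The cutoff function that is `1` on the ball of radius `r` and `0` outside that of radius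
`2 r`. -/
noncomputable def cutoff (r : ℝ) (x : E) : ℝ := max 0 (min 1 (2 - ‖x‖ / r))

theorem cutoff_nonneg (r : ℝ) (x : E) : 0 ≤ cutoff r x := le_max_left _ _

theorem cutoff_le_one (r : ℝ) (x : E) : cutoff r x ≤ 1 := max_le zero_le_one (min_le_left _ _)

theorem cutoff_eq_one {r : ℝ} (hr : 0 < r) {x : E} (h : ‖x‖ ≤ r) : cutoff r x = 1 := by
  have : ‖x‖ / r ≤ 1 := (div_le_one hr).2 h
  rw [cutoff, min_eq_left (by linarith), max_eq_right zero_le_one]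

theorem cutoff_eq_zero {r : ℝ} (hr : 0 < r) {x : E} (h : 2 * r ≤ ‖x‖) : cutoff r x = 0 := by
  have : 2 ≤ ‖x‖ / r := (le_div_iff₀ hr).2 h
  exact max_eq_left ((min_le_right _ _).trans (by linarith))

theorem abs_cutoff_sub_le {r : ℝ} (hr : 0 < r) (x y : E) :
    |cutoff r x - cutoff r y| ≤ ‖x - y‖ / r := by
  have h1 := abs_max_sub_max_le_abs (min 1 (2 - ‖x‖ / r)) (min 1 (2 - ‖y‖ / r)) 0
  have h2 := abs_min_sub_min_le_max 1 (2 - ‖x‖ / r) 1 (2 - ‖y‖ / r)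
  rw [sub_self, abs_zero, max_eq_right (abs_nonneg _)] at h2
  rw [cutoff, cutoff, max_comm 0, max_comm 0]
  refine (h1.trans h2).trans ?_
  rw [show 2 - ‖x‖ / r - (2 - ‖y‖ / r) = (‖y‖ - ‖x‖) / r by ring, abs_div, abs_of_pos hr]
  refine div_le_div_of_nonneg_right ?_ hr.le
  rw [norm_sub_rev]
  exact abs_norm_sub_norm_le y x

/-- Cutting off multiplies the Lipschitz constant of a function that vanishes at `0` by at
most `3`. -/
theorem abs_cutoff_mul_sub_le {f : E → ℝ} {L r : ℝ} (hr : 0 < r) (hL : 0 ≤ L) (h0 : f 0 = 0)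
    (hf : ∀ x y, |f x - f y| ≤ L * ‖x - y‖) (x y : E) :
    |cutoff r x * f x - cutoff r y * f y| ≤ 3 * L * ‖x - y‖ := by
  -- With `y` the point of smaller norm, the variation of the cutoff multiplies `f y`. Either both
  -- cutoffs vanish or `|f y| ≤ 2 * r * L`, which offsets the slope `1 / r`; hence `1 + 2 = 3`.
  wlog hxy : ‖y‖ ≤ ‖x‖ generalizing x y
  · rw [abs_sub_comm, norm_sub_rev]
    exact this y x (le_of_not_ge hxy)
  rcases le_total (2 * r) ‖y‖ with hy | hy
  · rw [cutoff_eq_zero hr hy, cutoff_eq_zero hr (hy.trans hxy)]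
    simp only [zero_mul, sub_self, abs_zero]
    positivity
  · have hfy : |f y| ≤ L * ‖y‖ := by simpa [h0] using hf y 0
    have h1 : |cutoff r x * (f x - f y)| ≤ L * ‖x - y‖ := by
      rw [abs_mul, abs_of_nonneg (cutoff_nonneg r x)]
      exact (mul_le_of_le_one_left (abs_nonneg _) (cutoff_le_one r x)).trans (hf x y)
    have h2 : |(cutoff r x - cutoff r y) * f y| ≤ 2 * L * ‖x - y‖ := by
      rw [abs_mul]
      calc |cutoff r x - cutoff r y| * |f y| ≤ ‖x - y‖ / r * (L * (2 * r)) :=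
            mul_le_mul (abs_cutoff_sub_le hr x y)
              (hfy.trans (mul_le_mul_of_nonneg_left hy hL)) (abs_nonneg _) (by positivity)
        _ = 2 * L * ‖x - y‖ := by field_simp
    calc |cutoff r x * f x - cutoff r y * f y|
        = |cutoff r x * (f x - f y) + (cutoff r x - cutoff r y) * f y| := by congr 1; ring
      _ ≤ L * ‖x - y‖ + 2 * L * ‖x - y‖ := (abs_add_le _ _).trans (add_le_add h1 h2)
      _ = 3 * L * ‖x - y‖ := by ring

end Bump

/-- Glueing of Lipschitz functions: the function `h k` vanishes where the index `κ` is not `k`. -/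
theorem abs_glue_sub_le {M : Type*} [PseudoMetricSpace M] {h : ℕ → M → ℝ} {κ : M → ℕ} {L : ℝ}
    (hκ : ∀ k x, κ x ≠ k → h k x = 0) (hL : ∀ k x y, |h k x - h k y| ≤ L * dist x y) (x y : M) :
    |h (κ x) x - h (κ y) y| ≤ 2 * L * dist x y := by
  by_cases hxy : κ x = κ y
  · have h1 := hL (κ x) x y
    have h2 : 0 ≤ L * dist x y := (abs_nonneg _).trans h1
    rw [← hxy]
    linarith
  -- Each of the two functions vanishes at the other point, so each value is itself a difference
  -- bounded by `L * dist x y`.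
  · have h1 := hL (κ x) x y
    have h2 := hL (κ y) x y
    rw [hκ _ y (Ne.symm hxy), sub_zero] at h1
    rw [hκ _ x hxy, zero_sub, abs_neg] at h2
    have h3 := abs_sub (h (κ x) x) (h (κ y) y)
    linarith

/-! ### Bounded sequences of functions stored in blocks of the lattice. -/

section Blocks

variable {ι : Type*} [Fintype ι]

/-- The inclusion of the integer lattice. -/
def latticeCast (z : ι → ℤ) : ι → ℝ := fun i => (z i : ℝ)

theorem dist_latticeCast (z w : ι → ℤ) : dist (latticeCast z) (latticeCast w) = dist z w :=
  LipZero.isometry_intCast_pi.dist_eq z w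

/-- The center of the `k`-th block, of radius `4 ^ k`. -/
def blockCenter (ι : Type*) (k : ℕ) : ι → ℤ := fun _ => 4 ^ (k + 1)

/-- The index of the block that a lattice point belongs to. -/
noncomputable def blockIndex (z : ι → ℤ) : ℕ := Nat.log 4 (⌊‖latticeCast z‖ / 3⌋₊)

theorem norm_blockCenter [Nonempty ι] (k : ℕ) : ‖latticeCast (blockCenter ι k)‖ = 4 ^ (k + 1) := by
  have : latticeCast (blockCenter ι k) = fun _ => (4 : ℝ) ^ (k + 1) := by
    funext i
    simp [latticeCast, blockCenter]
  rw [this, pi_norm_const, Real.norm_of_nonneg (by positivity)]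

/-- On the `k`-th block the norm lies between `3 * 4 ^ k` and `5 * 4 ^ k`, and `5 / 3 < 4`. Thus the
norm alone determines the block, and the blocks are disjoint. -/
theorem blockIndex_eq [Nonempty ι] {z : ι → ℤ} {k : ℕ}
    (h : ‖latticeCast z - latticeCast (blockCenter ι k)‖ < 4 ^ k) : blockIndex z = k := by
  have h1 := abs_le.1 (abs_norm_sub_norm_le (latticeCast z) (latticeCast (blockCenter ι k)))
  rw [norm_blockCenter, pow_succ] at h1
  have hp : (0 : ℝ) < 4 ^ k := by positivity
  refine Nat.log_eq_of_pow_le_of_lt_pow ?_ ?_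
  · refine Nat.le_floor ?_
    push_cast
    linarith [h1.1]
  · refine (Nat.floor_lt (by positivity)).2 ?_
    push_cast
    rw [pow_succ]
    linarith [h1.2]

/-- A rescaled and cut off copy, on the `k`-th block, of a function on `ℝ ^ ι`. -/
noncomputable def blockCopy (F : (ι → ℝ) → ℝ) (k : ℕ) (s : ℝ) (z : ι → ℤ) : ℝ :=
  cutoff (4 ^ k / 2) (latticeCast z - latticeCast (blockCenter ι k)) *
    (s * F (s⁻¹ • (latticeCast z - latticeCast (blockCenter ι k))))

theorem blockCopy_add (F G : (ι → ℝ) → ℝ) (k : ℕ) (s : ℝ) (z : ι → ℤ) :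
    blockCopy (fun x => F x + G x) k s z = blockCopy F k s z + blockCopy G k s z := by
  simp only [blockCopy]
  ring

theorem blockCopy_const_mul (c : ℝ) (F : (ι → ℝ) → ℝ) (k : ℕ) (s : ℝ) (z : ι → ℤ) :
    blockCopy (fun x => c * F x) k s z = c * blockCopy F k s z := by
  simp only [blockCopy]
  ring

/-- The cutoff of radius `4 ^ k / 2` vanishes from distance `4 ^ k` on. Points outside all blocks
also carry an index, harmlessly. -/
theorem blockCopy_eq_zero [Nonempty ι] (F : (ι → ℝ) → ℝ) {k : ℕ} (s : ℝ) {z : ι → ℤ}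
    (h : blockIndex z ≠ k) : blockCopy F k s z = 0 := by
  have h1 : (4 : ℝ) ^ k ≤ ‖latticeCast z - latticeCast (blockCenter ι k)‖ :=
    not_lt.1 fun h2 => h (blockIndex_eq h2)
  rw [blockCopy, cutoff_eq_zero (by positivity) (by linarith), zero_mul]

theorem blockCopy_zero [Nonempty ι] (F : (ι → ℝ) → ℝ) (k : ℕ) (s : ℝ) : blockCopy F k s 0 = 0 := by
  have h1 : latticeCast (0 : ι → ℤ) = 0 := funext fun _ => Int.cast_zero
  rw [blockCopy, h1, zero_sub, cutoff_eq_zero (by positivity), zero_mul]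
  rw [norm_neg, norm_blockCenter, pow_succ]
  linarith [show (0 : ℝ) < 4 ^ k by positivity]

/-- The rescaling `s * f (s⁻¹ • x)` keeps the Lipschitz constant, so the bound is uniform in `k` and
`s`; the `3` comes from the cutoff. -/
theorem abs_blockCopy_sub_le (f : LipZero (ι → ℝ) 0) (k : ℕ) {s : ℝ} (hs : 0 < s)
    (z w : ι → ℤ) : |blockCopy f k s z - blockCopy f k s w| ≤ 3 * ‖f‖ * dist z w := by
  have h := abs_cutoff_mul_sub_le (E := ι → ℝ) (f := fun x => s * f (s⁻¹ • x)) (L := ‖f‖)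
    (r := 4 ^ k / 2) (by positivity) (norm_nonneg f)
    (by simp [f.apply_base]) (fun x y => by
      rw [← mul_sub, abs_mul, abs_of_pos hs]
      calc s * |f (s⁻¹ • x) - f (s⁻¹ • y)| ≤ s * (‖f‖ * dist (s⁻¹ • x) (s⁻¹ • y)) :=
            mul_le_mul_of_nonneg_left (f.abs_sub_le _ _) hs.le
        _ = ‖f‖ * ‖x - y‖ := by
            rw [dist_smul₀, Real.norm_of_nonneg (inv_nonneg.2 hs.le), dist_eq_norm]
            field_simp)
    (latticeCast z - latticeCast (blockCenter ι k))
    (latticeCast w - latticeCast (blockCenter ι k))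
  rwa [sub_sub_sub_cancel_right, ← dist_eq_norm, dist_latticeCast] at h

/-- The blocks are filled with copies of the members of a sequence, each of them at the scales
`2 ^ n` for all `n`. -/
noncomputable def fillBlocks (F : ℕ → (ι → ℝ) → ℝ) (z : ι → ℤ) : ℝ :=
  blockCopy (F (blockIndex z).unpair.1) (blockIndex z) (2 ^ (blockIndex z).unpair.2) z

theorem abs_fillBlocks_sub_le [Nonempty ι] (F : ℕ →ᵇ LipZero (ι → ℝ) 0) (z w : ι → ℤ) :
    |fillBlocks (fun m => F m) z - fillBlocks (fun m => F m) w| ≤ 6 * ‖F‖ * dist z w := by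
  refine (abs_glue_sub_le (L := 3 * ‖F‖)
    (h := fun k => blockCopy (F k.unpair.1) k (2 ^ k.unpair.2))
    (fun k z hz => blockCopy_eq_zero _ _ hz) (fun k z w => ?_) z w).trans (by linarith)
  refine (abs_blockCopy_sub_le _ _ (by positivity) z w).trans ?_
  exact mul_le_mul_of_nonneg_right (mul_le_mul_of_nonneg_left (F.norm_coe_le_norm _)
    (by norm_num)) dist_nonneg

/-- The operator that fills the blocks with the members of a bounded sequence. -/
noncomputable def fillBlocksL (ι : Type*) [Fintype ι] [Nonempty ι] :
    (ℕ →ᵇ LipZero (ι → ℝ) 0) →L[ℝ] LipZero (ι → ℤ) 0 :=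
  LinearMap.mkContinuous
    { toFun := fun F => LipZero.mk' (fillBlocks fun m => F m) _ (abs_fillBlocks_sub_le F)
        (blockCopy_zero _ _ _)
      map_add' := fun F G => LipZero.ext fun z => by
        exact blockCopy_add _ _ _ _ z
      map_smul' := fun c F => LipZero.ext fun z => by
        exact blockCopy_const_mul c _ _ _ z }
    6 fun F => LipZero.norm_le (by positivity) (abs_fillBlocks_sub_le F)

/-- The rescaled function around the center of the block of index `(m, n)`. -/
noncomputable def zoom (G : (ι → ℤ) → ℝ) (m : ℕ) (y : ι → ℝ) (n : ℕ) : ℝ :=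
  (2 ^ n)⁻¹ * (G (blockCenter ι (Nat.pair m n) + floorVec ((2 : ℝ) ^ n • y)) -
    G (blockCenter ι (Nat.pair m n)))

theorem zoom_add {ι : Type*} (F G : (ι → ℤ) → ℝ) (m : ℕ) (y : ι → ℝ) (n : ℕ) :
    zoom (fun z => F z + G z) m y n = zoom F m y n + zoom G m y n := by
  simp only [zoom]
  ring

theorem zoom_const_mul {ι : Type*} (c : ℝ) (G : (ι → ℤ) → ℝ) (m : ℕ) (y : ι → ℝ) (n : ℕ) :
    zoom (fun z => c * G z) m y n = c * zoom G m y n := by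
  simp only [zoom]
  ring

/-- Rounding to the lattice costs at most `1`, which becomes `(2 ^ n)⁻¹` after rescaling and
disappears in the limit. -/
theorem abs_zoom_sub_le (G : LipZero (ι → ℤ) 0) (m : ℕ) (x y : ι → ℝ) (n : ℕ) :
    |zoom G m x n - zoom G m y n| ≤ ‖G‖ * (dist x y + (2 ^ n)⁻¹) := by
  have h2 : (0 : ℝ) < 2 ^ n := by positivity
  rw [zoom, zoom, ← mul_sub, sub_sub_sub_cancel_right, abs_mul, abs_of_pos (inv_pos.2 h2)]
  have h3 := G.abs_sub_le (blockCenter ι (Nat.pair m n) + floorVec ((2 : ℝ) ^ n • x))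
    (blockCenter ι (Nat.pair m n) + floorVec ((2 : ℝ) ^ n • y))
  have h4 := dist_floorVec_le ((2 : ℝ) ^ n • x) ((2 : ℝ) ^ n • y)
  rw [dist_smul₀, Real.norm_of_nonneg h2.le] at h4
  rw [dist_add_left] at h3
  calc (2 ^ n)⁻¹ * |_| ≤ (2 ^ n)⁻¹ * (‖G‖ * (2 ^ n * dist x y + 1)) :=
        mul_le_mul_of_nonneg_left (h3.trans (mul_le_mul_of_nonneg_left h4 (norm_nonneg G)))
          (inv_nonneg.2 h2.le)
    _ = ‖G‖ * (dist x y + (2 ^ n)⁻¹) := by field_simp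

theorem zoom_zero {ι : Type*} (G : (ι → ℤ) → ℝ) (m n : ℕ) : zoom G m 0 n = 0 := by
  have h : floorVec (0 : ι → ℝ) = 0 := funext fun _ => Int.floor_zero
  rw [zoom, smul_zero, h, add_zero, sub_self, mul_zero]

theorem tendsto_zoom (G : LipZero (ι → ℤ) 0) (m : ℕ) (y : ι → ℝ) :
    Tendsto (zoom G m y) (hyperfilter ℕ : Filter ℕ) (𝓝 (ultralimit (zoom G m y))) := by
  refine tendsto_ultralimit (C := ‖G‖ * (dist y 0 + 1)) fun n => ?_
  have h := abs_zoom_sub_le G m y 0 n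
  rw [zoom_zero, sub_zero] at h
  refine h.trans (mul_le_mul_of_nonneg_left ?_ (norm_nonneg G))
  exact add_le_add_right (inv_le_one_of_one_le₀ (one_le_pow₀ one_le_two)) _

theorem abs_ultralimit_zoom_sub_le (G : LipZero (ι → ℤ) 0) (m : ℕ) (x y : ι → ℝ) :
    |ultralimit (zoom G m x) - ultralimit (zoom G m y)| ≤ ‖G‖ * dist x y := by
  have h1 := ((tendsto_zoom G m x).sub (tendsto_zoom G m y)).abs
  have h2 : Tendsto (fun n : ℕ => ‖G‖ * (dist x y + ((2 : ℝ) ^ n)⁻¹))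
      (hyperfilter ℕ : Filter ℕ) (𝓝 (‖G‖ * (dist x y + 0))) :=
    (((tendsto_inv_atTop_zero.comp (tendsto_pow_atTop_atTop_of_one_lt one_lt_two)).const_add
      _).const_mul _).mono_left Nat.hyperfilter_le_atTop
  rw [add_zero] at h2
  exact le_of_tendsto_of_tendsto' h1 h2 (abs_zoom_sub_le G m x y)

/-- The function on `ℝ ^ ι` that is the limit of the rescaled functions on the blocks of
index `(m, n)`. -/
noncomputable def zoomLimit (G : LipZero (ι → ℤ) 0) (m : ℕ) : LipZero (ι → ℝ) 0 :=
  LipZero.mk' (fun y => ultralimit (zoom G m y)) _ (abs_ultralimit_zoom_sub_le G m) (by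
    have h : zoom G m 0 = fun _ => 0 := funext (zoom_zero G m)
    rw [h]
    exact ultralimit_eq_of_tendsto tendsto_const_nhds)

theorem norm_zoomLimit_le (G : LipZero (ι → ℤ) 0) (m : ℕ) : ‖zoomLimit G m‖ ≤ ‖G‖ :=
  LipZero.norm_le (norm_nonneg G) (abs_ultralimit_zoom_sub_le G m)

/-- The operator that recovers a bounded sequence from the blocks. -/
noncomputable def zoomLimitL (ι : Type*) [Fintype ι] :
    LipZero (ι → ℤ) 0 →L[ℝ] (ℕ →ᵇ LipZero (ι → ℝ) 0) :=
  LinearMap.mkContinuous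
    { toFun := fun G => BoundedContinuousFunction.ofNormedAddCommGroupDiscrete (zoomLimit G) ‖G‖
        (norm_zoomLimit_le G)
      map_add' := fun F G => by
        refine BoundedContinuousFunction.ext fun m => LipZero.ext fun y => ?_
        -- Additivity of the limit relies on actual convergence, which `tendsto_zoom` supplies for
        -- every `G`.
        refine tendsto_nhds_unique (tendsto_zoom (F + G) m y)
          (((tendsto_zoom F m y).add (tendsto_zoom G m y)).congr fun n => ?_)
        exact (zoom_add F G m y n).symm
      map_smul' := fun c G => by
        refine BoundedContinuousFunction.ext fun m => LipZero.ext fun y => ?_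
        refine tendsto_nhds_unique (tendsto_zoom (c • G) m y)
          (((tendsto_zoom G m y).const_mul c).congr fun n => ?_)
        exact (zoom_const_mul c G m y n).symm }
    1 fun G => by
      rw [one_mul]
      exact BoundedContinuousFunction.norm_ofNormedAddCommGroup_le _ (norm_nonneg G)
        (norm_zoomLimit_le G)

/-- On the inner half of the block the cutoff is `1`, so the copy is exact. -/
theorem fillBlocks_add_blockCenter [Nonempty ι] (F : ℕ →ᵇ LipZero (ι → ℝ) 0) (m n : ℕ) {w : ι → ℤ}
    (hw : ‖latticeCast w‖ ≤ 4 ^ Nat.pair m n / 2) :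
    fillBlocks (fun m => F m) (blockCenter ι (Nat.pair m n) + w) =
      2 ^ n * F m ((2 ^ n : ℝ)⁻¹ • latticeCast w) := by
  have h1 : latticeCast (blockCenter ι (Nat.pair m n) + w) -
      latticeCast (blockCenter ι (Nat.pair m n)) = latticeCast w := by
    funext i
    simp [latticeCast]
  have hp : (0 : ℝ) < 4 ^ Nat.pair m n := by positivity
  have h2 : blockIndex (blockCenter ι (Nat.pair m n) + w) = Nat.pair m n :=
    blockIndex_eq (by rw [h1]; linarith)
  rw [fillBlocks, h2, Nat.unpair_pair, blockCopy, h1, cutoff_eq_one (by positivity) hw, one_mul]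

theorem norm_latticeCast_floorVec_le (x : ι → ℝ) : ‖latticeCast (floorVec x) - x‖ ≤ 1 := by
  refine (pi_norm_le_iff_of_nonneg zero_le_one).2 fun i => ?_
  have h1 := Int.floor_le (x i)
  have h2 := Int.lt_floor_add_one (x i)
  rw [Pi.sub_apply, Real.norm_eq_abs, abs_le, latticeCast, floorVec]
  constructor <;> linarith

theorem tendsto_zoom_fillBlocks [Nonempty ι] (F : ℕ →ᵇ LipZero (ι → ℝ) 0) (m : ℕ) (y : ι → ℝ) :
    Tendsto (zoom (fillBlocks fun m => F m) m y) atTop (𝓝 (F m y)) := by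
  have hinv : Tendsto (fun n : ℕ => ((2 : ℝ) ^ n)⁻¹) atTop (𝓝 0) :=
    tendsto_inv_atTop_zero.comp (tendsto_pow_atTop_atTop_of_one_lt one_lt_two)
  -- This yields `2 ^ n * ‖y‖ + 1 ≤ 4 ^ n / 2 ≤ 4 ^ Nat.pair m n / 2`: block radii outgrow the
  -- scales, so the rounded point eventually lies in the inner half.
  have hlarge : ∀ᶠ n : ℕ in atTop, 2 * (‖y‖ + 1) ≤ (2 : ℝ) ^ n :=
    (tendsto_pow_atTop_atTop_of_one_lt one_lt_two).eventually_ge_atTop _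
  refine tendsto_iff_norm_sub_tendsto_zero.2 (squeeze_zero' (g := fun n : ℕ =>
    ‖F m‖ * ((2 : ℝ) ^ n)⁻¹) (Eventually.of_forall fun n => norm_nonneg _) ?_ ?_)
  · filter_upwards [hlarge] with n hn
    have h2 : (1 : ℝ) ≤ 2 ^ n := one_le_pow₀ one_le_two
    have hd := norm_latticeCast_floorVec_le ((2 : ℝ) ^ n • y)
    have hw : ‖latticeCast (floorVec ((2 : ℝ) ^ n • y))‖ ≤ 4 ^ Nat.pair m n / 2 := by
      have h3 := norm_le_norm_add_norm_sub' (latticeCast (floorVec ((2 : ℝ) ^ n • y)))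
        ((2 : ℝ) ^ n • y)
      rw [norm_smul, Real.norm_of_nonneg (by positivity)] at h3
      have h4 : (4 : ℝ) ^ n ≤ 4 ^ Nat.pair m n :=
        pow_le_pow_right₀ (by norm_num) (Nat.right_le_pair m n)
      have h5 : (4 : ℝ) ^ n = 2 ^ n * 2 ^ n := by rw [← mul_pow]; norm_num
      nlinarith [norm_nonneg y]
    have h0 : ‖latticeCast (0 : ι → ℤ)‖ ≤ 4 ^ Nat.pair m n / 2 := by
      have : latticeCast (0 : ι → ℤ) = 0 := funext fun _ => Int.cast_zero
      rw [this, norm_zero]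
      positivity
    have e0 := fillBlocks_add_blockCenter F m n h0
    have e1 : latticeCast (0 : ι → ℤ) = 0 := funext fun _ => Int.cast_zero
    rw [add_zero, e1, smul_zero, (F m).apply_base, mul_zero] at e0
    rw [zoom, e0, sub_zero, fillBlocks_add_blockCenter F m n hw, inv_mul_cancel_left₀
      (by positivity)]
    refine ((F m).abs_sub_le _ _).trans (mul_le_mul_of_nonneg_left ?_ (norm_nonneg _))
    have e2 : dist ((2 ^ n : ℝ)⁻¹ • latticeCast (floorVec ((2 : ℝ) ^ n • y))) y =
        (2 ^ n : ℝ)⁻¹ * ‖latticeCast (floorVec ((2 : ℝ) ^ n • y)) - (2 : ℝ) ^ n • y‖ := by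
      conv_lhs => rw [← inv_smul_smul₀ (show (2 : ℝ) ^ n ≠ 0 by positivity) y]
      rw [dist_smul₀, dist_eq_norm, Real.norm_of_nonneg (by positivity),
        smul_inv_smul₀ (by positivity)]
    rw [e2]
    exact mul_le_of_le_one_right (by positivity) hd
  · simpa using hinv.const_mul ‖F m‖

/-- On filled blocks the rescalings converge in the ordinary sense, so the choice of ultrafilter
does not affect the result. -/
theorem zoomLimitL_fillBlocksL [Nonempty ι] :
    Function.LeftInverse (zoomLimitL ι) (fillBlocksL ι) := fun F =>
  BoundedContinuousFunction.ext fun m => LipZero.ext fun y =>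
    ultralimit_eq_of_tendsto (tendsto_zoom_fillBlocks F m y)

end Blocks

/-! ### The isomorphism. -/

namespace LipZero

/-- The spaces over `ℤ ^ ι` and `ℝ ^ ι`, with the supremum metric, are isomorphic. -/
theorem nonempty_lattice_equiv (ι : Type*) [Fintype ι] :
    Nonempty (LipZero (ι → ℤ) 0 ≃L[ℝ] LipZero (ι → ℝ) 0) := by
  -- For empty `ι` all block centers collapse to the origin, but both spaces are trivial.
  cases isEmpty_or_nonempty ι
  · have hsub : ∀ (G : Type) [MetricSpace G] [Zero G], Subsingleton (LipZero (ι → G) 0) :=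
      fun G _ _ => ⟨fun f g => ext fun x => by
        rw [Subsingleton.elim x 0, f.apply_base, g.apply_base]⟩
    have := hsub ℤ
    have := hsub ℝ
    exact ⟨ContinuousLinearEquiv.equivOfInverse 0 0 (fun _ => Subsingleton.elim _ _)
      fun _ => Subsingleton.elim _ _⟩
  · exact nonempty_equiv_of_complemented (extension ι) (restriction ι) restriction_extension
      (fillBlocksL ι) (zoomLimitL ι) zoomLimitL_fillBlocksL

end LipZero

theorem mainTheorem1 (d : ℕ) (p q : ℝ≥0∞) [Fact (1 ≤ p)] [Fact (1 ≤ q)] :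
    Nonempty (LipZero (PiLp p (fun _ : Fin d => ℤ)) 0 ≃L[ℝ]
      LipZero (PiLp q (fun _ : Fin d => ℝ)) 0) := by
  obtain ⟨e⟩ := LipZero.nonempty_lattice_equiv (Fin d)
  exact ⟨((LipZero.piLpEquiv p (Fin d) ℤ).symm.trans e).trans (LipZero.piLpEquiv q (Fin d) ℝ)⟩
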